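/- Let $(\tilde Z_t)_{t\in\mathbb R_+}$ be a time-homogeneous continuous-time Markov chain with right-continuous paths, with countable (discrete) state space $E\subseteq\mathbb N$, arbitrary initial law, and transition rates $\tilde Q_{n,n'}\ge 0$ (with $\tilde Q_{n,n}=0$). That is, its transition probabilities satisfy, as $h\downarrow0$, $P_h(n,n')=\tilde Q_{n,n'}h+o(h)$ for $n'\ne n$ and $P_h(n,n)=1-\tilde d_n h+o(h)$, where $\tilde d_n=\sum_{n'\in E}\tilde Q_{n,n'}<\infty$ is the sum of all outgoing rates from $n$. Assume $\tilde d_n>0$ for all $n\in E$. Let $\tilde{\mathcal F}\subseteq E\times E$ be such that $\tilde Q_{n,n'}>0$ for all $(n,n')\in\tilde{\mathcal F}$. For $t\ge0$ let $$\tilde Y_t=\inf\{s>0:\ (\tilde Z_{(t+s)^-},\tilde Z_{(t+s)^+})\in\tilde{\mathcal F}\}\in[0,\infty]$$ be the time that elapses from $t$ until the next jump in $\tilde{\mathcal F}$ (with $\inf\emptyset=\infty$, and $e^{-\nu\cdot\infty}:=0$). Then $\tilde Y_t$ is a random variable for every $t\ge 0$. For every $\nu\in\mathbb C$ with $\operatorname{Re}\nu\ge0$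 and every $n\in E$, the conditional Laplace–Stieltjes transform $\mathbb E[e^{-\nu\tilde Y_t}\mid\tilde Z_t=n]$ has the same value $\tilde f_n(\nu)$ for all $t\ge0$ with $\mathbb P(\tilde Z_t=n)>0$. For every such $\nu$ and every $n$ with $\mathbb P(\tilde Z_t=n)>0$ for some $t\ge0$, $$\tilde f_n(\nu)=\frac1{\tilde d_n+\nu}\left(\sum_{n':\,(n,n')\notin\tilde{\mathcal F}}\tilde f_{n'}(\nu)\,\tilde Q_{n,n'}+\sum_{n':\,(n,n')\in\tilde{\mathcal F}}\tilde Q_{n,n'}\right),$$ where the series converge absolutely. (If $n'$ is such that $\mathbb P(\tilde Z_t=n')=0$ for all $t$, then $\tilde Q_{n,n'}=0$ in this formula, so that the value given to $\tilde f_{n'}(\nu)$ is irrelevant.) -/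

import Mathlib

open MeasureTheory ProbabilityTheory Filter Topology
open scoped NNReal ENNReal

namespace CTMC

/-- A (standard, honest) transition function on the countable state space `E`:
`P t n m` is the probability to be in `m` a time `t` after having been in `n`. -/
structure IsTransitionFunction {E : Set ℕ} (P : ℝ≥0 → E → E → ℝ) : Prop where
  nonneg : ∀ t n m, 0 ≤ P t n m
  hasSum_one : ∀ t n, HasSum (P t n) 1
  zero_self : ∀ n, P 0 n n = 1
  chapman_kolmogorov : ∀ s t n m, HasSum (fun k => P s n k * P t k m) (P (s + t) n m)

/-- The sum of all outgoing rates from state `n`. -/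
noncomputable def totalRate {E : Set ℕ} (Q : E → E → ℝ) (n : E) : ℝ := ∑' m, Q n m

/-- `Q` is the family of transition rates of `P`. As `Q n m` is the rate of the transitions out of
`n` into `m`, its diagonal is zero (the diagonal of the generator is `-totalRate Q n`).
In other words `P h n m = Q n m * h + o(h)` for `m ≠ n` and
`P h n n = 1 - totalRate Q n * h + o(h)`. -/
structure HasTransitionRates {E : Set ℕ} (P : ℝ≥0 → E → E → ℝ) (Q : E → E → ℝ) : Prop where
  diag : ∀ n, Q n n = 0
  summable : ∀ n, Summable (Q n)
  tendsto_off_diag : ∀ n m, n ≠ m →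
    Tendsto (fun h : ℝ≥0 => P h n m / (h : ℝ)) (𝓝[>] 0) (𝓝 (Q n m))
  tendsto_diag : ∀ n,
    Tendsto (fun h : ℝ≥0 => (1 - P h n n) / (h : ℝ)) (𝓝[>] 0) (𝓝 (totalRate Q n))

/-- The σ-algebra generated by `Z u`, `u ≤ s`. -/
abbrev past {Ω : Type*} {E : Set ℕ} (Z : ℝ≥0 → Ω → E) (s : ℝ≥0) : MeasurableSpace Ω :=
  ⨆ u : Set.Iic s, MeasurableSpace.comap (Z u) inferInstance

/-- `Z` is a time-homogeneous continuous-time Markov chain under `μ` with transition function `P`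
(and with an arbitrary initial law): it has right-continuous paths in the discrete space `E`, and
`μ(Z (s + t) = m | Z u, u ≤ s) = P t (Z s) m` almost surely. -/
structure IsMarkovChain {Ω : Type*} [MeasurableSpace Ω] {E : Set ℕ}
    (Z : ℝ≥0 → Ω → E) (μ : Measure Ω) (P : ℝ≥0 → E → E → ℝ) : Prop where
  measurable : ∀ t, Measurable (Z t)
  right_continuous : ∀ ω t, ContinuousWithinAt (fun s => Z s ω) (Set.Ici t) t
  markov : ∀ (s t : ℝ≥0) (m : E),
    μ[Set.indicator {ω | Z (s + t) ω = m} (fun _ => (1 : ℝ)) | past Z s]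
      =ᵐ[μ] fun ω => P t (Z s ω) m

/-- The path `z` has its left and right limits at time `u`, and `(z (u-), z (u+)) ∈ F`. -/
def JumpsAt {E : Set ℕ} (z : ℝ≥0 → E) (F : Set (E × E)) (u : ℝ≥0) : Prop :=
  ∃ p ∈ F, Tendsto z (𝓝[<] u) (𝓝 p.1) ∧ Tendsto z (𝓝[>] u) (𝓝 p.2)

/-- The time that elapses from `t` until the next jump in `F`,
`inf {s > 0 | (Z ((t + s)-), Z ((t + s)+)) ∈ F}`; it is `∞` if there is no such jump. -/
noncomputable def timeToNextJump {Ω : Type*} {E : Set ℕ} (Z : ℝ≥0 → Ω → E) (F : Set (E × E))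
    (t : ℝ≥0) (ω : Ω) : ℝ≥0∞ :=
  sInf ((fun s : ℝ≥0 => (s : ℝ≥0∞)) '' {s | 0 < s ∧ JumpsAt (fun r => Z r ω) F (t + s)})

/-- `exp (-ν y)`, with value `0` at `y = ∞`. -/
noncomputable def laplaceKernel (ν : ℂ) (y : ℝ≥0∞) : ℂ :=
  if y = ∞ then 0 else Complex.exp (-ν * (y.toReal : ℂ))

/-- The conditional Laplace–Stieltjes transform at `ν`, given `Z t = n`, of the time from `t`
until the next jump in `F`. It is meaningful if `Z t = n` has positive probability. -/
noncomputable def condLST {Ω : Type*} [MeasurableSpace Ω] {E : Set ℕ} (Z : ℝ≥0 → Ω → E)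
    (μ : Measure Ω) (F : Set (E × E)) (t : ℝ≥0) (n : E) (ν : ℂ) : ℂ :=
  ∫ ω, laplaceKernel ν (timeToNextJump Z F t ω) ∂(ProbabilityTheory.cond μ {ω | Z t ω = n})

end CTMC

/-! The equation comes from a decomposition over a short interval of length `h` after a time `s`
with `Z s = n`. Let `stepEvent Z s n m h` be the event that the path passes from `n` to `m` in this
interval through no other state. If `(n, m) ∈ F`, the awaited jump occurs within time `h`, and the
kernel differs from `exp (-ν h)` by `O(h)`. Otherwise no jump of `F` occurs before `s + h`: the
kernel is exactly `exp (-ν h)` times the kernel restarted at `s + h`, and the Markov property turns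
the latter into the transform from `m`. Dividing by `h` times the mass of `{Z s = n}` and letting `h
→ 0` yields `stateLST_mul_eq`.

The limit needs the masses of the step events to first order. The transition function bounds them
above; sampling the path on dyadic grids bounds them below (`mul_exp_le_real_stepEvent_self`,
`mul_rate_le_real_stepEvent`). Both agree to order `h`, and the total of the limits is `totalRate Q
n`, so no mass of order `h` is left for paths with several transitions. Scheffé's lemma makes the
convergence uniform enough to exchange the limit with the sum over `m`. Everything is local at `s`,
so accumulation of jumps elsewhere is harmless.

Measurability and independence of `t` rest on another observation: for right-continuous paths the
next jump time is a function of countably many values (`nextJump_eq_sampledJump`). It is therefore a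
measurable function on the product space, and the law of the shifted path given `Z t = n`, fixed by
its finite-dimensional marginals, does not depend on `t` (`map_shift_cond_eq`). -/

namespace CTMC

/-! ### Jumps of right-continuous paths and their detection from countably many times -/

variable {E : Set ℕ}

/-- The path `w` is right-continuous in the discrete space `E`. -/
def RightCont (w : ℝ≥0 → E) : Prop := ∀ t, ∃ r, t < r ∧ ∀ x, t ≤ x → x < r → w x = w t

theorem rightCont_of_continuousWithinAt {w : ℝ≥0 → E}
    (hw : ∀ t, ContinuousWithinAt w (Set.Ici t) t) : RightCont w := by
  intro t
  have h := hw t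
  rw [ContinuousWithinAt, nhds_discrete, tendsto_pure] at h
  obtain ⟨r, hr, hs⟩ := mem_nhdsGE_iff_exists_Ico_subset.1 h
  exact ⟨r, hr, fun x h1 h2 => hs ⟨h1, h2⟩⟩

theorem RightCont.shift {w : ℝ≥0 → E} (hw : RightCont w) (t : ℝ≥0) :
    RightCont fun u => w (t + u) := by
  intro u
  obtain ⟨r, hr, h⟩ := hw (t + u)
  have ht : t ≤ r := le_self_add.trans hr.le
  refine ⟨r - t, lt_tsub_iff_left.2 hr, fun x h1 h2 => h _ (by gcongr) (lt_tsub_iff_left.1 h2)⟩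

/-- The path `w` jumps at time `s` from one state to another, and this transition belongs
to `F`. -/
def StepsAt (w : ℝ≥0 → E) (F : Set (E × E)) (s : ℝ≥0) : Prop :=
  ∃ p ∈ F, w s = p.2 ∧ ∃ q < s, ∀ x, q ≤ x → x < s → w x = p.1

/-- In a discrete space a limit is an eventual value, and right-continuity makes the right limit `w
s`. Positivity of `s` is essential: `𝓝[<] 0` is trivial. -/
theorem jumpsAt_iff_stepsAt {w : ℝ≥0 → E} (hw : RightCont w) (F : Set (E × E)) {s : ℝ≥0}
    (hs : 0 < s) : JumpsAt w F s ↔ StepsAt w F s := by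
  have hright : ∀ b : E, Tendsto w (𝓝[>] s) (𝓝 b) ↔ w s = b := by
    intro b
    obtain ⟨r, hr, h⟩ := hw s
    have hev : ∀ᶠ x in 𝓝[>] s, w x = w s := by
      filter_upwards [Ioo_mem_nhdsGT hr] with x hx using h x hx.1.le hx.2
    have hlim : Tendsto w (𝓝[>] s) (𝓝 (w s)) := by
      rw [nhds_discrete, tendsto_pure]; exact hev
    exact ⟨fun hb => tendsto_nhds_unique hlim hb, fun hb => hb ▸ hlim⟩
  have hleft : ∀ a : E, Tendsto w (𝓝[<] s) (𝓝 a) ↔ ∃ q < s, ∀ x, q ≤ x → x < s → w x = a := by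
    intro a
    rw [nhds_discrete, tendsto_pure, Filter.Eventually, mem_nhdsLT_iff_exists_Ioo_subset' hs]
    constructor
    · rintro ⟨q, hq, h⟩
      obtain ⟨r, hqr, hrs⟩ := exists_between (Set.mem_Iio.1 hq)
      exact ⟨r, hrs, fun x h1 h2 => h ⟨hqr.trans_le h1, h2⟩⟩
    · rintro ⟨q, hq, h⟩
      exact ⟨q, hq, fun x hx => h x hx.1.le hx.2⟩
  constructor
  · rintro ⟨p, hp, h1, h2⟩
    exact ⟨p, hp, (hright _).1 h2, (hleft _).1 h1⟩
  · rintro ⟨p, hp, h1, h2⟩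
    exact ⟨p, hp, (hleft _).2 h2, (hright _).2 h1⟩

theorem stepsAt_shift (w : ℝ≥0 → E) (F : Set (E × E)) (t : ℝ≥0) {s : ℝ≥0} (hs : 0 < s) :
    StepsAt (fun u => w (t + u)) F s ↔ StepsAt w F (t + s) := by
  constructor
  · rintro ⟨p, hp, h1, q, hq, h⟩
    refine ⟨p, hp, h1, t + q, by gcongr, fun x hx1 hx2 => ?_⟩
    obtain ⟨y, rfl⟩ := exists_add_of_le (le_self_add.trans hx1)
    exact h y (by simpa using hx1) (by simpa using hx2)
  · rintro ⟨p, hp, h1, q, hq, h⟩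
    refine ⟨p, hp, h1, q - t, ?_, fun x hx1 hx2 => h _ (tsub_le_iff_left.1 hx1) (by gcongr)⟩
    rcases le_total q t with hqt | hqt
    · rwa [tsub_eq_zero_of_le hqt]
    · exact (tsub_lt_iff_left hqt).2 hq

/-- The time of the first jump of `w` in `F`. -/
noncomputable def nextJump (F : Set (E × E)) (w : ℝ≥0 → E) : ℝ≥0∞ :=
  sInf ((fun s : ℝ≥0 => (s : ℝ≥0∞)) '' {s | 0 < s ∧ StepsAt w F s})

theorem timeToNextJump_eq_nextJump {Ω : Type*} {Z : ℝ≥0 → Ω → E} {ω : Ω}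
    (hw : RightCont fun r => Z r ω) (F : Set (E × E)) (t : ℝ≥0) :
    timeToNextJump Z F t ω = nextJump F (fun u => Z (t + u) ω) := by
  unfold timeToNextJump nextJump
  congr 2
  ext s
  refine and_congr_right fun hs => ?_
  rw [stepsAt_shift (fun r => Z r ω) F t hs, jumpsAt_iff_stepsAt hw F (by positivity)]

/-- On `T ∩ [q, r]` the path `w` first is in `a` and then in `b`. -/
def StepOn (T : Set ℝ≥0) (w : ℝ≥0 → E) (a b : E) (q r : ℝ≥0) : Prop :=
  w q = a ∧ w r = b ∧ ∀ x ∈ T, ∀ y ∈ T, q ≤ x → x ≤ y → y ≤ r →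
    (w x = a ∨ w x = b) ∧ (w x = b → w y = b)

theorem StepOn.mono {T T' : Set ℝ≥0} {w : ℝ≥0 → E} {a b : E} {q r : ℝ≥0} (hT : T ⊆ T')
    (h : StepOn T' w a b q r) : StepOn T w a b q r :=
  ⟨h.1, h.2.1, fun x hx y hy => h.2.2 x (hT hx) y (hT hy)⟩

/-- By right-continuity the value at any `x < r` is taken again at a point of `T` slightly to the
right, so order relations between values carry over from `T`. The endpoint `r` has no such point
inside the interval, but there the value is known. -/
theorem StepOn.univ_of_dense {T : Set ℝ≥0} {w : ℝ≥0 → E} (hw : RightCont w) {a b : E}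
    {q r : ℝ≥0} (hT : ∀ x y, q ≤ x → x < y → y ≤ r → ∃ u ∈ T, x < u ∧ u < y)
    (h : StepOn T w a b q r) : StepOn Set.univ w a b q r := by
  obtain ⟨ha, hb, h⟩ := h
  have key : ∀ x, q ≤ x → x < r → ∀ v, x < v → ∃ u ∈ T, x < u ∧ u < v ∧ u ≤ r ∧ w u = w x := by
    intro x h1 h2 v hv
    obtain ⟨z, hz, hzw⟩ := hw x
    obtain ⟨u, hu, hu1, hu2⟩ := hT x (min v (min z r)) h1 (lt_min hv (lt_min hz h2)) (by simp)
    simp only [lt_min_iff] at hu2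
    exact ⟨u, hu, hu1, hu2.1, hu2.2.2.le, hzw u hu1.le hu2.2.1⟩
  refine ⟨ha, hb, fun x _ y _ hqx hxy hyr => ⟨?_, fun hx => ?_⟩⟩
  · rcases (hxy.trans hyr).eq_or_lt with rfl | hxr
    · exact Or.inr hb
    · obtain ⟨u, hu, h1, -, h3, h4⟩ := key x hqx hxr r hxr
      rw [← h4]
      exact (h u hu u hu (hqx.trans h1.le) le_rfl h3).1
  · rcases hxy.eq_or_lt with rfl | hxy
    · exact hx
    rcases hyr.eq_or_lt with rfl | hyr
    · exact hb
    obtain ⟨u, hu, h1, h2, -, h4⟩ := key x hqx (hxy.trans hyr) y hxy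
    obtain ⟨v, hv, k1, -, k3, k4⟩ := key y (hqx.trans hxy.le) hyr r hyr
    rw [← k4]
    exact (h u hu v hv (hqx.trans h1.le) (h2.trans k1).le k3).2 (h4.trans hx)

/-- The jump takes place at the infimum of the times spent in `b`, which is attained by
right-continuity. -/
theorem StepOn.exists_stepsAt {w : ℝ≥0 → E} (hw : RightCont w) {F : Set (E × E)} {a b : E}
    {q r : ℝ≥0} (hqr : q ≤ r) (hab : (a, b) ∈ F) (hne : a ≠ b)
    (h : StepOn Set.univ w a b q r) : ∃ s, q < s ∧ s ≤ r ∧ StepsAt w F s := by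
  obtain ⟨ha, hb, h⟩ := h
  set S : Set ℝ≥0 := {x | q ≤ x ∧ w x = b}
  have hrS : r ∈ S := ⟨hqr, hb⟩
  have hS : S.Nonempty := ⟨r, hrS⟩
  have hbelow : BddBelow S := OrderBot.bddBelow S
  have hqs : q ≤ sInf S := le_csInf hS fun x hx => hx.1
  have hsr : sInf S ≤ r := csInf_le hbelow hrS
  obtain ⟨v, hv, hvw⟩ := hw (sInf S)
  obtain ⟨x, hxS, hxv⟩ := exists_lt_of_csInf_lt hS hv
  have hws : w (sInf S) = b := by rw [← hvw x (csInf_le hbelow hxS) hxv, hxS.2]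
  have hlt : q < sInf S := by
    refine lt_of_le_of_ne hqs fun he => hne ?_
    rw [← ha, ← hws, ← he]
  refine ⟨sInf S, hlt, hsr, (a, b), hab, hws, q, hlt, fun y hy1 hy2 => ?_⟩
  refine ((h y trivial y trivial hy1 le_rfl (hy2.le.trans hsr)).1).resolve_right fun hyb => ?_
  exact absurd (csInf_le hbelow (show y ∈ S from ⟨hy1, hyb⟩)) (not_le.2 hy2)

theorem nextJump_le {F : Set (E × E)} {w : ℝ≥0 → E} {s : ℝ≥0} (hs : 0 < s)
    (h : StepsAt w F s) : nextJump F w ≤ s :=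
  sInf_le ⟨s, ⟨hs, h⟩, rfl⟩

theorem nextJump_le_of_stepOn {F : Set (E × E)} {w : ℝ≥0 → E} (hw : RightCont w) {a b : E}
    {q r : ℝ≥0} (hqr : q ≤ r) (hab : (a, b) ∈ F) (hne : a ≠ b)
    (h : StepOn Set.univ w a b q r) : nextJump F w ≤ r := by
  obtain ⟨s, h1, h2, h3⟩ := h.exists_stepsAt hw hqr hab hne
  exact (nextJump_le (pos_of_gt h1) h3).trans (by exact_mod_cast h2)

/-- The only change of state possible up to time `h` is from `a` to `b`, which is not in `F`; so the
wait starts afresh at `h`. The case `a = b` is included. -/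
theorem nextJump_eq_add_of_stepOn {F : Set (E × E)} (hF : ∀ p ∈ F, p.1 ≠ p.2) {w : ℝ≥0 → E}
    {a b : E} {h : ℝ≥0} (hab : (a, b) ∉ F) (hw : StepOn Set.univ w a b 0 h) :
    nextJump F w = h + nextJump F (fun u => w (h + u)) := by
  have hgt : ∀ s, StepsAt w F s → h < s := by
    rintro s ⟨p, hp, hps, q, hq, hpq⟩
    by_contra! hsh
    have hq' := hpq q le_rfl hq
    have h1 := (hw.2.2 q trivial s trivial (zero_le) hq.le hsh)
    have h2 := (hw.2.2 s trivial s trivial (zero_le) le_rfl hsh).1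
    rw [hps, hq'] at h1
    rw [hps] at h2
    have hne := hF p hp
    rcases h1 with ⟨h1 | h1, h3⟩
    · rcases h2 with h2 | h2
      · exact hne (h1.trans h2.symm)
      · exact hab (by rw [← h1, ← h2]; exact hp)
    · exact hne (h1.trans (h3 h1).symm)
  apply le_antisymm
  · rw [nextJump, nextJump, sInf_image', sInf_image', ENNReal.add_iInf]
    refine le_iInf fun ⟨s, hs, hj⟩ => ?_
    refine iInf_le_of_le ⟨h + s, by positivity, (stepsAt_shift w F h hs).1 hj⟩ ?_
    simp
  · rw [nextJump]
    refine le_sInf ?_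
    rintro _ ⟨s, ⟨hs, hj⟩, rfl⟩
    have hlt := hgt s hj
    obtain ⟨u, rfl⟩ := exists_add_of_le hlt.le
    have hu : 0 < u := by simpa using hlt
    have := nextJump_le hu ((stepsAt_shift w F h hu).2 hj)
    simp only [ENNReal.coe_add]
    rw [nextJump] at this
    gcongr

open Classical in
/-- The time of the first jump in `F`, read off the values of the path on `T`. -/
noncomputable def sampledJump (T : Set ℝ≥0) (F : Set (E × E)) (w : ℝ≥0 → E) : ℝ≥0∞ :=
  ⨅ (p : F) (q : T) (r : T),
    if (q : ℝ≥0) ≤ r ∧ StepOn T w p.1.1 p.1.2 q r then ((r : ℝ≥0) : ℝ≥0∞) else ∞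

theorem measurableSet_stepOn {T : Set ℝ≥0} (hT : T.Countable) (a b : E) (q r : ℝ≥0) :
    MeasurableSet {w : ℝ≥0 → E | StepOn T w a b q r} := by
  have hev : ∀ x (c : E), MeasurableSet {w : ℝ≥0 → E | w x = c} := fun x c =>
    have hx : Measurable fun w : ℝ≥0 → E => w x := measurable_pi_apply x
    hx (measurableSet_singleton c)
  simp only [StepOn, Set.ofPred_and, Set.ofPred_forall]
  refine (hev q a).inter ((hev r b).inter ?_)
  refine .biInter hT fun x _ => .biInter hT fun y _ => .iInter fun _ => .iInter fun _ =>
    .iInter fun _ => ?_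
  exact ((hev x a).union (hev x b)).inter ((hev x b).imp (hev y b))

theorem measurable_sampledJump {T : Set ℝ≥0} (hT : T.Countable) (F : Set (E × E)) :
    Measurable (sampledJump T F) := by
  have := hT.to_subtype
  refine .iInf fun p => .iInf fun q => .iInf fun r => ?_
  refine Measurable.ite ?_ measurable_const measurable_const
  exact (MeasurableSet.const _).inter (measurableSet_stepOn hT _ _ _ _)

/-- A step seen on `T` is a genuine step, with its jump no later than `r`. Conversely, a jump at `s`
is seen from points of `T` on both sides, the right one as close to `s` as desired. Without `hF`, a
constant stretch would count as a step. -/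
theorem nextJump_eq_sampledJump {T : Set ℝ≥0} (hT : Dense T) {F : Set (E × E)}
    (hF : ∀ p ∈ F, p.1 ≠ p.2) {w : ℝ≥0 → E} (hw : RightCont w) :
    nextJump F w = sampledJump T F w := by
  apply le_antisymm
  · refine le_iInf fun p => le_iInf fun q => le_iInf fun r => ?_
    split_ifs with h
    · refine nextJump_le_of_stepOn hw h.1 p.2 (hF _ p.2) (h.2.univ_of_dense hw ?_)
      intro x y _ hxy _
      obtain ⟨u, hu, hux⟩ := hT.exists_between hxy
      exact ⟨u, hu, hux⟩
    · exact le_top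
  · refine le_sInf ?_
    rintro _ ⟨s, ⟨hs, p, hp, hps, q, hq, hpq⟩, rfl⟩
    refine le_of_forall_gt_imp_ge_of_dense fun c hc => ?_
    obtain ⟨v, hv, hvw⟩ := hw s
    obtain ⟨d, hd, hdc⟩ := ENNReal.lt_iff_exists_nnreal_btwn.1 hc
    have hd : s < d := ENNReal.coe_lt_coe.1 hd
    obtain ⟨q', hq'T, hq'1, hq'2⟩ := hT.exists_between (Set.mem_Iio.1 hq)
    obtain ⟨r, hrT, hr1, hr2⟩ := hT.exists_between (lt_min hv hd)
    rw [lt_min_iff] at hr2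
    refine iInf_le_of_le ⟨p, hp⟩ (iInf_le_of_le ⟨q', hq'T⟩ (iInf_le_of_le ⟨r, hrT⟩ ?_))
    have hbefore : ∀ x, q' ≤ x → x < s → w x = p.1 := fun x h1 => hpq x (hq'1.le.trans h1)
    have hafter : ∀ x, s ≤ x → x ≤ r → w x = p.2 := fun x h1 h2 =>
      (hvw x h1 (h2.trans_lt hr2.1)).trans hps
    rw [if_pos]
    · exact (ENNReal.coe_le_coe.2 hr2.2.le).trans hdc.le
    refine ⟨(hq'2.trans hr1).le, hbefore _ le_rfl hq'2, hafter _ hr1.le le_rfl,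
      fun x _ y _ h1 h2 h3 => ⟨?_, fun hx => ?_⟩⟩
    · rcases lt_or_ge x s with h | h
      · exact Or.inl (hbefore x h1 h)
      · exact Or.inr (hafter x h (h2.trans h3))
    · rcases lt_or_ge x s with h | h
      · exact absurd ((hbefore x h1 h).symm.trans hx) (hF p hp)
      · exact hafter y (h.trans h2) h3

end CTMC

/-! ### The Markov property on path space -/

namespace CTMC

theorem measurable_past {Ω : Type*} {E : Set ℕ} (Z : ℝ≥0 → Ω → E) {u s : ℝ≥0}
    (h : u ≤ s) : Measurable[past Z s] (Z u) :=
  Measurable.of_comap_le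
    (le_iSup (fun u : Set.Iic s => MeasurableSpace.comap (Z u) inferInstance) ⟨u, h⟩)

theorem measurableSet_past_eq {Ω : Type*} {E : Set ℕ} (Z : ℝ≥0 → Ω → E)
    {u s : ℝ≥0} (h : u ≤ s) (x : E) :
    MeasurableSet[past Z s] {ω | Z u ω = x} :=
  measurable_past Z h (measurableSet_singleton x)

theorem past_mono {Ω : Type*} {E : Set ℕ} (Z : ℝ≥0 → Ω → E) {s t : ℝ≥0}
    (h : s ≤ t) : past Z s ≤ past Z t :=
  iSup_le fun u => (measurable_past Z (u.2.trans h)).comap_le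

variable {Ω : Type*} [MeasurableSpace Ω] {μ : Measure Ω} {E : Set ℕ} {Z : ℝ≥0 → Ω → E}
  {P : ℝ≥0 → E → E → ℝ}

namespace IsMarkovChain

theorem past_le (hZ : IsMarkovChain Z μ P) (s : ℝ≥0) : past Z s ≤ ‹MeasurableSpace Ω› :=
  iSup_le fun u => (hZ.measurable u).comap_le

theorem rightCont (hZ : IsMarkovChain Z μ P) (ω : Ω) : RightCont fun t => Z t ω :=
  rightCont_of_continuousWithinAt (hZ.right_continuous ω)

theorem measurableSet_eq (hZ : IsMarkovChain Z μ P) (s : ℝ≥0) (x : E) :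
    MeasurableSet {ω | Z s ω = x} :=
  hZ.measurable s (measurableSet_singleton x)

theorem measurable_shift (hZ : IsMarkovChain Z μ P) (s : ℝ≥0) :
    Measurable fun ω (u : ℝ≥0) => Z (s + u) ω :=
  measurable_pi_lambda _ fun _ => hZ.measurable _

theorem measurable_timeToNextJump (hZ : IsMarkovChain Z μ P) {F : Set (E × E)}
    (hF : ∀ p ∈ F, p.1 ≠ p.2) (t : ℝ≥0) : Measurable (timeToNextJump Z F t) := by
  obtain ⟨T, hTc, hTd⟩ := TopologicalSpace.exists_countable_dense ℝ≥0
  have : timeToNextJump Z F t = fun ω => sampledJump T F fun u => Z (t + u) ω := by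
    ext1 ω
    rw [timeToNextJump_eq_nextJump (hZ.rightCont ω),
      nextJump_eq_sampledJump hTd hF ((hZ.rightCont ω).shift t)]
  rw [this]
  exact (measurable_sampledJump hTc F).comp (hZ.measurable_shift t)

variable [IsProbabilityMeasure μ]

/-- On `A` the conditional probability is the constant `P t x y`; integrate it over `A`. -/
theorem real_inter_eq (hZ : IsMarkovChain Z μ P) {s : ℝ≥0} {A : Set Ω} {x : E}
    (hA : MeasurableSet[past Z s] A) (hAx : A ⊆ {ω | Z s ω = x}) (t : ℝ≥0) (y : E) :
    μ.real (A ∩ {ω | Z (s + t) ω = y}) = μ.real A * P t x y := by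
  have hA' := hZ.past_le s _ hA
  have hy := hZ.measurableSet_eq (s + t) y
  have hint : Integrable (Set.indicator {ω | Z (s + t) ω = y} fun _ => (1 : ℝ)) μ :=
    (integrable_const _).indicator hy
  have h1 := setIntegral_condExp (hZ.past_le s) hint hA
  rw [setIntegral_congr_ae (g := fun _ => P t x y) hA', setIntegral_const,
    setIntegral_indicator hy, setIntegral_const] at h1
  · simpa using h1.symm
  · filter_upwards [hZ.markov s t y] with ω hω hωA
    rw [hω, hAx hωA]

/-- The point is the order of quantifiers: `c` is the same for all `s` and `A`. The induction adds
the times in increasing order and applies the Markov property at the last earlier time. -/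
theorem exists_cylinder_eq (hZ : IsMarkovChain Z μ P) (n : E) (x : ℝ≥0 → E) (I : Finset ℝ≥0) :
    ∃ c : ℝ, ∀ (s : ℝ≥0) (A : Set Ω), MeasurableSet[past Z s] A → A ⊆ {ω | Z s ω = n} →
      μ.real (A ∩ {ω | ∀ q ∈ I, Z (s + q) ω = x q}) = μ.real A * c := by
  induction I using Finset.induction_on_max with
  | empty => exact ⟨1, fun s A _ _ => by simp⟩
  | insert a I ha ih =>
    obtain ⟨c, hc⟩ := ih
    rcases I.eq_empty_or_nonempty with rfl | hI
    · refine ⟨P a n (x a), fun s A hA hAn => ?_⟩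
      simpa using hZ.real_inter_eq hA hAn a (x a)
    · obtain ⟨q, hq, hmax⟩ : ∃ q ∈ I, ∀ r ∈ I, r ≤ q :=
        ⟨I.max' hI, I.max'_mem hI, fun r hr => I.le_max' r hr⟩
      refine ⟨c * P (a - q) (x q) (x a), fun s A hA hAn => ?_⟩
      have hB : MeasurableSet[past Z (s + q)] (A ∩ {ω | ∀ r ∈ I, Z (s + r) ω = x r}) := by
        refine .inter (past_mono Z le_self_add _ hA) ?_
        simp only [Set.ofPred_forall]
        exact Finset.measurableSet_biInter _ fun r hr =>
          measurableSet_past_eq Z (by gcongr; exact hmax r hr) _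
      have h1 := hZ.real_inter_eq hB (x := x q) (fun ω hω => hω.2 q hq) (a - q) (x a)
      rw [add_assoc, add_tsub_cancel_of_le (ha q hq).le, hc s A hA hAn] at h1
      rw [← mul_assoc, ← h1]
      congr 1
      ext ω
      simp only [Finset.mem_insert, forall_eq_or_imp, Set.mem_inter_iff, Set.mem_ofPred_eq]
      tauto

/-- A law on the product space is determined by its finite-dimensional marginals. These live on
countable spaces, hence are determined by singletons, whose masses are the constants of
`exists_cylinder_eq`. -/
theorem map_shift_cond_eq (hZ : IsMarkovChain Z μ P) {n : E} {s t : ℝ≥0} {A B : Set Ω}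
    (hA : MeasurableSet[past Z s] A) (hAn : A ⊆ {ω | Z s ω = n}) (hA0 : μ A ≠ 0)
    (hB : MeasurableSet[past Z t] B) (hBn : B ⊆ {ω | Z t ω = n}) (hB0 : μ B ≠ 0) :
    (cond μ A).map (fun ω u => Z (s + u) ω) = (cond μ B).map (fun ω u => Z (t + u) ω) := by
  have := cond_isProbabilityMeasure hA0
  have := cond_isProbabilityMeasure hB0
  have key : ∀ (I : Finset ℝ≥0) (x : I → E), ∃ c : ℝ, ∀ (s : ℝ≥0) (A : Set Ω),
      MeasurableSet[past Z s] A → A ⊆ {ω | Z s ω = n} → μ A ≠ 0 →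
      ((cond μ A).map (fun ω u => Z (s + u) ω)).map I.restrict {x} = ENNReal.ofReal c := by
    intro I x
    classical
    -- The value `n` outside `I` is a filler that is never read.
    obtain ⟨c, hc⟩ := hZ.exists_cylinder_eq n (fun q => if h : q ∈ I then x ⟨q, h⟩ else n) I
    refine ⟨c, fun s A hA hAn hA0 => ?_⟩
    have := cond_isProbabilityMeasure hA0
    rw [Measure.map_map (Finset.measurable_restrict I) (hZ.measurable_shift s),
      Measure.map_apply ((Finset.measurable_restrict I).comp (hZ.measurable_shift s))
        (measurableSet_singleton x), ← ofReal_measureReal]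
    congr 1
    rw [measureReal_def, cond_apply (hZ.past_le s _ hA), ENNReal.toReal_mul, ENNReal.toReal_inv,
      ← measureReal_def, ← measureReal_def]
    have hAr : μ.real A ≠ 0 := by simpa [measureReal_eq_zero_iff] using hA0
    rw [inv_mul_eq_iff_eq_mul₀ hAr, ← hc s A hA hAn]
    congr 2
    ext ω
    simp only [Set.mem_preimage, Function.comp, Set.mem_singleton_iff, funext_iff,
      Finset.restrict, Subtype.forall, Set.mem_ofPred_eq]
    exact forall₂_congr fun q hq => by rw [dif_pos hq]
  refine IsProjectiveLimit.unique (P := fun I : Finset ℝ≥0 =>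
    ((cond μ A).map (fun ω u => Z (s + u) ω)).map I.restrict) (fun I => rfl) fun I => ?_
  refine Measure.ext_of_singleton fun x => ?_
  obtain ⟨c, hc⟩ := key I x
  rw [hc s A hA hAn hA0, hc t B hB hBn hB0]

end IsMarkovChain

/-! ### The kernel and the transform from a given state -/

theorem measurable_laplaceKernel (ν : ℂ) : Measurable (laplaceKernel ν) := by
  unfold laplaceKernel
  exact Measurable.ite (measurableSet_singleton _) measurable_const (by fun_prop)

theorem norm_laplaceKernel_le {ν : ℂ} (hν : 0 ≤ ν.re) (y : ℝ≥0∞) : ‖laplaceKernel ν y‖ ≤ 1 := by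
  unfold laplaceKernel
  split_ifs
  · simp
  · rw [Complex.norm_exp]
    simpa using mul_nonneg hν ENNReal.toReal_nonneg

theorem laplaceKernel_add (ν : ℂ) (h : ℝ≥0) (y : ℝ≥0∞) :
    laplaceKernel ν (h + y) = Complex.exp (-ν * (h : ℝ)) * laplaceKernel ν y := by
  unfold laplaceKernel
  by_cases hy : y = ∞
  · simp [hy]
  · have : (h : ℝ≥0∞) + y ≠ ∞ := by simp [hy]
    rw [if_neg hy, if_neg this, ← Complex.exp_add, ENNReal.toReal_add (by simp) hy]
    push_cast
    simp only [ENNReal.coe_toReal]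
    ring_nf

/-- With `h = y + z`, the difference is the kernel at `y` times `1 - exp (-ν z)`, and `‖exp u - 1‖ ≤
2 ‖u‖` for `‖u‖ ≤ 1`. Comparing with `exp (-ν h)` rather than `1` gives all transitions the same
factor later on. -/
theorem norm_laplaceKernel_sub_le {ν : ℂ} (hν : 0 ≤ ν.re) {y : ℝ≥0∞} {h : ℝ≥0} (hy : y ≤ h)
    (hh : ‖ν‖ * h ≤ 1) : ‖laplaceKernel ν y - Complex.exp (-ν * (h : ℝ))‖ ≤ 2 * ‖ν‖ * h := by
  obtain ⟨z, hz⟩ := exists_add_of_le hy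
  have hz' : z ≤ h := hz ▸ le_add_self
  lift z to ℝ≥0 using ne_top_of_le_ne_top ENNReal.coe_ne_top hz'
  lift y to ℝ≥0 using ne_top_of_le_ne_top ENNReal.coe_ne_top hy
  have hz' : z ≤ h := ENNReal.coe_le_coe.1 hz'
  have hzh : ‖-ν * (z : ℝ)‖ ≤ ‖ν‖ * h := by
    rw [norm_mul, norm_neg, Complex.norm_real, Real.norm_of_nonneg z.coe_nonneg]
    gcongr
  have hyz : h = y + z := by exact_mod_cast hz
  have h1 : laplaceKernel ν y - Complex.exp (-ν * (h : ℝ)) =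
      - (laplaceKernel ν y * (Complex.exp (-ν * (z : ℝ)) - 1)) := by
    rw [hyz, laplaceKernel, if_neg ENNReal.coe_ne_top]
    simp only [ENNReal.coe_toReal]
    push_cast
    rw [mul_add, Complex.exp_add]
    ring
  rw [h1, norm_neg, norm_mul]
  calc _ ≤ 1 * (2 * ‖-ν * (z : ℝ)‖) := by
        gcongr
        · exact norm_laplaceKernel_le hν _
        · exact Complex.norm_exp_sub_one_le (hzh.trans hh)
    _ ≤ _ := by linarith

open Classical in
/-- The conditional Laplace–Stieltjes transform of the time until the next jump in `F` from the
state `n`, at any time at which the chain is in `n` with positive probability. -/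
noncomputable def stateLST (Z : ℝ≥0 → Ω → E) (μ : Measure Ω) (F : Set (E × E)) (n : E)
    (ν : ℂ) : ℂ :=
  if h : ∃ t, μ {ω | Z t ω = n} ≠ 0 then condLST Z μ F h.choose n ν else 0

theorem norm_stateLST_le [IsProbabilityMeasure μ] (F : Set (E × E)) (n : E) {ν : ℂ}
    (hν : 0 ≤ ν.re) : ‖stateLST Z μ F n ν‖ ≤ 1 := by
  unfold stateLST
  split_ifs with h
  · have := cond_isProbabilityMeasure h.choose_spec
    refine (norm_integral_le_of_norm_le_const (C := 1)
      (ae_of_all _ fun ω => norm_laplaceKernel_le hν _)).trans ?_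
    simp
  · simp

namespace IsMarkovChain

theorem integrable_laplaceKernel {μ' : Measure Ω} [IsFiniteMeasure μ']
    (hZ : IsMarkovChain Z μ P) {F : Set (E × E)}
    (hF : ∀ p ∈ F, p.1 ≠ p.2) {ν : ℂ} (hν : 0 ≤ ν.re) (s : ℝ≥0) :
    Integrable (fun ω => laplaceKernel ν (timeToNextJump Z F s ω)) μ' :=
  .of_bound ((measurable_laplaceKernel ν).comp
    (hZ.measurable_timeToNextJump hF s)).aestronglyMeasurable 1
    (ae_of_all _ fun _ => norm_laplaceKernel_le hν _)

variable [IsProbabilityMeasure μ]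

/-- Conditioning on an arbitrary past event `A` inside `{Z s = n}` is needed to restart the chain
after a step event. -/
theorem integral_cond_laplaceKernel (hZ : IsMarkovChain Z μ P) {F : Set (E × E)}
    (hF : ∀ p ∈ F, p.1 ≠ p.2) (ν : ℂ) {n : E} {s : ℝ≥0} {A : Set Ω}
    (hA : MeasurableSet[past Z s] A) (hAn : A ⊆ {ω | Z s ω = n}) (hA0 : μ A ≠ 0) :
    ∫ ω, laplaceKernel ν (timeToNextJump Z F s ω) ∂(cond μ A) = stateLST Z μ F n ν := by
  have h : ∃ t, μ {ω | Z t ω = n} ≠ 0 := ⟨s, fun h0 => hA0 (measure_mono_null hAn h0)⟩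
  rw [stateLST, dif_pos h, condLST]
  generalize h.choose = t, h.choose_spec = ht
  obtain ⟨T, hTc, hTd⟩ := TopologicalSpace.exists_countable_dense ℝ≥0
  have hm : Measurable fun w : ℝ≥0 → E => laplaceKernel ν (sampledJump T F w) :=
    (measurable_laplaceKernel ν).comp (measurable_sampledJump hTc F)
  have key : ∀ (t : ℝ≥0) (B : Set Ω), ∫ ω, laplaceKernel ν (timeToNextJump Z F t ω) ∂(cond μ B) =
      ∫ w, laplaceKernel ν (sampledJump T F w) ∂(cond μ B).map (fun ω u => Z (t + u) ω) := by
    intro t B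
    rw [integral_map (hZ.measurable_shift t).aemeasurable hm.aestronglyMeasurable]
    congr 1 with ω
    rw [timeToNextJump_eq_nextJump (hZ.rightCont ω),
      nextJump_eq_sampledJump hTd hF ((hZ.rightCont ω).shift t)]
  rw [key, key, hZ.map_shift_cond_eq hA hAn hA0 (measurableSet_past_eq Z le_rfl n) subset_rfl ht]

theorem setIntegral_laplaceKernel (hZ : IsMarkovChain Z μ P) {F : Set (E × E)}
    (hF : ∀ p ∈ F, p.1 ≠ p.2) (ν : ℂ) {n : E} {s : ℝ≥0} {A : Set Ω}
    (hA : MeasurableSet[past Z s] A) (hAn : A ⊆ {ω | Z s ω = n}) :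
    ∫ ω in A, laplaceKernel ν (timeToNextJump Z F s ω) ∂μ = μ.real A * stateLST Z μ F n ν := by
  by_cases hA0 : μ A = 0
  -- This covers the states that are never occupied: the default value of `stateLST` is multiplied
  -- by zero.
  · simp [Measure.restrict_eq_zero.2 hA0, measureReal_def, hA0]
  · rw [← hZ.integral_cond_laplaceKernel hF ν hA hAn hA0, ProbabilityTheory.cond,
      integral_smul_measure,
      Complex.real_smul, ← mul_assoc, measureReal_def, ENNReal.toReal_inv, ← Complex.ofReal_mul,
      mul_inv_cancel₀ (ENNReal.toReal_ne_zero.2 ⟨hA0, measure_ne_top _ _⟩)]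
    simp

end IsMarkovChain

end CTMC

/-! ### First-order bounds for step events via dyadic grids -/

namespace CTMC

variable {E : Set ℕ}

theorem IsTransitionFunction.le_one {P : ℝ≥0 → E → E → ℝ} (hP : IsTransitionFunction P)
    (t : ℝ≥0) (n m : E) : P t n m ≤ 1 :=
  le_hasSum (hP.hasSum_one t n) m fun k _ => hP.nonneg t n k

theorem tendsto_div_natCast_nhdsGT {h : ℝ≥0} (hh : 0 < h) :
    Tendsto (fun N : ℕ => h / N) atTop (𝓝[>] 0) := by
  rw [tendsto_nhdsWithin_iff]
  refine ⟨tendsto_const_div_atTop_nhds_zero_nat h, ?_⟩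
  filter_upwards [eventually_gt_atTop 0] with N hN
  have : (0 : ℝ≥0) < N := by exact_mod_cast hN
  exact div_pos hh this

/-- This is `(1 + u / N) ^ N → exp u` with `u` replaced by `N (P (h / N) n n - 1)`, which tends to
`-(h * totalRate Q n)`. -/
theorem HasTransitionRates.tendsto_pow {P : ℝ≥0 → E → E → ℝ} {Q : E → E → ℝ}
    (hQ : HasTransitionRates P Q) (n : E) {h : ℝ≥0} (hh : 0 < h) :
    Tendsto (fun N : ℕ => P (h / N) n n ^ N) atTop (𝓝 (Real.exp (-(h * totalRate Q n)))) := by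
  have h1 := ((hQ.tendsto_diag n).comp (tendsto_div_natCast_nhdsGT hh)).const_mul (h : ℝ)
  have h2 : Tendsto (fun N : ℕ => (N : ℝ) * (P (h / N) n n - 1)) atTop
      (𝓝 (-(h * totalRate Q n))) := by
    refine h1.neg.congr' ?_
    filter_upwards [eventually_gt_atTop 0] with N hN
    have : (N : ℝ) ≠ 0 := by positivity
    have : (h : ℝ) ≠ 0 := by exact_mod_cast hh.ne'
    simp only [Function.comp]
    push_cast
    field_simp
    ring
  simpa using Real.tendsto_one_add_pow_exp_of_tendsto h2

/-- The multiples of `h / 2 ^ j`. -/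
def dyadicGrid (h : ℝ≥0) (j : ℕ) : Set ℝ≥0 := Set.range fun k : ℕ => k * (h / 2 ^ j)

theorem monotone_dyadicGrid (h : ℝ≥0) : Monotone (dyadicGrid h) := by
  refine monotone_nat_of_le_succ fun j => ?_
  rintro _ ⟨k, rfl⟩
  refine ⟨2 * k, ?_⟩
  simp only [pow_succ]
  push_cast
  field_simp

theorem exists_dyadicGrid_between {h : ℝ≥0} (hh : 0 < h) {x y : ℝ≥0} (hxy : x < y) :
    ∃ j, ∃ u ∈ dyadicGrid h j, x < u ∧ u < y := by
  obtain ⟨j, hj⟩ : ∃ j : ℕ, h / 2 ^ j < y - x := by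
    have h1 : Tendsto (fun j : ℕ => h / 2 ^ j) atTop (𝓝 0) := by
      have := (tendsto_const_div_atTop_nhds_zero_nat h).comp
        (tendsto_pow_atTop_atTop_of_one_lt one_lt_two)
      refine this.congr fun j => by simp
    exact (h1.eventually_lt_const (tsub_pos_of_lt hxy)).exists
  have hδ : 0 < h / 2 ^ j := by positivity
  refine ⟨j, _, ⟨⌊x / (h / 2 ^ j)⌋₊ + 1, rfl⟩, ?_, ?_⟩
  · have := Nat.lt_floor_add_one (x / (h / 2 ^ j))
    rw [div_lt_iff₀ hδ] at this
    exact_mod_cast this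
  · have h1 : (⌊x / (h / 2 ^ j)⌋₊ : ℝ≥0) * (h / 2 ^ j) ≤ x := by
      rw [← le_div_iff₀ hδ]
      exact Nat.floor_le zero_le
    push_cast
    rw [add_mul, one_mul]
    calc _ ≤ x + h / 2 ^ j := by gcongr
      _ < y := lt_tsub_iff_left.1 hj

/-- The grids are nested, so two points of their dense union lie in a common grid. This presents the
step event as a decreasing countable intersection. -/
theorem stepOn_univ_iff_forall_dyadicGrid {w : ℝ≥0 → E} (hw : RightCont w) {h : ℝ≥0}
    (hh : 0 < h) (a b : E) :
    StepOn Set.univ w a b 0 h ↔ ∀ j, StepOn (dyadicGrid h j) w a b 0 h := by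
  refine ⟨fun H j => H.mono (Set.subset_univ _), fun H => ?_⟩
  have : StepOn (⋃ j, dyadicGrid h j) w a b 0 h := by
    refine ⟨(H 0).1, (H 0).2.1, fun x hx y hy => ?_⟩
    obtain ⟨i, hi⟩ := Set.mem_iUnion.1 hx
    obtain ⟨j, hj⟩ := Set.mem_iUnion.1 hy
    exact (H (max i j)).2.2 x (monotone_dyadicGrid h (le_max_left _ _) hi) y
      (monotone_dyadicGrid h (le_max_right _ _) hj)
  refine this.univ_of_dense hw fun x y _ hxy _ => ?_
  obtain ⟨j, u, hu, h1⟩ := exists_dyadicGrid_between hh hxy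
  exact ⟨u, Set.mem_iUnion.2 ⟨j, hu⟩, h1⟩

/-- If `w` is in `a` at the first `k` points of the grid and in `b` at the others, it steps from
`a` to `b` on the grid. -/
theorem stepOn_dyadicGrid {w : ℝ≥0 → E} {h : ℝ≥0} (hh : 0 < h) {a b : E} {j k : ℕ}
    (h0 : w 0 = a) (hN : w h = b)
    (hw : ∀ i : ℕ, i ≤ 2 ^ j → w (i * (h / 2 ^ j)) = if i ≤ k then a else b) :
    StepOn (dyadicGrid h j) w a b 0 h := by
  have hδ : 0 < h / 2 ^ j := by positivity
  refine ⟨h0, hN, ?_⟩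
  rintro _ ⟨x, rfl⟩ _ ⟨y, rfl⟩ - hxy hy
  simp only at hxy hy ⊢
  have hxy : x ≤ y := by exact_mod_cast le_of_mul_le_mul_right hxy hδ
  have hy : y ≤ 2 ^ j := by
    have : (y : ℝ≥0) * (h / 2 ^ j) ≤ (2 ^ j : ℕ) * (h / 2 ^ j) := by
      refine hy.trans_eq ?_
      push_cast
      field_simp
    exact_mod_cast le_of_mul_le_mul_right this hδ
  rw [hw x (hxy.trans hy), hw y hy]
  split_ifs with h1 h2 h2
  · simp
  · simp
  · omega
  · simp

/-- The event that the chain goes from `n` to `m` between `s` and `s + h`, without visiting other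
states; for `m = n` that it stays in `n`. -/
def stepEvent {Ω : Type*} (Z : ℝ≥0 → Ω → E) (s : ℝ≥0) (n m : E) (h : ℝ≥0) : Set Ω :=
  {ω | StepOn Set.univ (fun u => Z (s + u) ω) n m 0 h}

theorem stepEvent_subset_left {Ω : Type*} {Z : ℝ≥0 → Ω → E} (s : ℝ≥0) (n m : E) (h : ℝ≥0) :
    stepEvent Z s n m h ⊆ {ω | Z s ω = n} := fun ω hω => by simpa using hω.1

theorem stepEvent_subset_right {Ω : Type*} {Z : ℝ≥0 → Ω → E} (s : ℝ≥0) (n m : E) (h : ℝ≥0) :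
    stepEvent Z s n m h ⊆ {ω | Z (s + h) ω = m} := fun _ hω => hω.2.1

theorem pairwise_disjoint_stepEvent {Ω : Type*} {Z : ℝ≥0 → Ω → E} (s : ℝ≥0) (n : E) (h : ℝ≥0) :
    Pairwise (Function.onFun Disjoint fun m => stepEvent Z s n m h) := fun a b hab =>
  Set.disjoint_left.2 fun _ ha hb =>
    hab ((stepEvent_subset_right s n a h ha).symm.trans (stepEvent_subset_right s n b h hb))

variable {Ω : Type*} [MeasurableSpace Ω] {μ : Measure Ω} {Z : ℝ≥0 → Ω → E}
  {P : ℝ≥0 → E → E → ℝ} {Q : E → E → ℝ}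

namespace IsMarkovChain

theorem measurableSet_past_stepEvent (hZ : IsMarkovChain Z μ P) (s : ℝ≥0) (n m : E) {h : ℝ≥0}
    (hh : 0 < h) : MeasurableSet[past Z (s + h)] (stepEvent Z s n m h) := by
  have : stepEvent Z s n m h = {ω | Z (s + 0) ω = n} ∩ ({ω | Z (s + h) ω = m} ∩
      ⋂ j, ⋂ x ∈ dyadicGrid h j, ⋂ y ∈ dyadicGrid h j, {ω | 0 ≤ x → x ≤ y → y ≤ h →
        (Z (s + x) ω = n ∨ Z (s + x) ω = m) ∧ (Z (s + x) ω = m → Z (s + y) ω = m)}) := by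
    ext ω
    rw [stepEvent, Set.mem_ofPred_eq,
      stepOn_univ_iff_forall_dyadicGrid ((hZ.rightCont ω).shift s) hh]
    simp only [StepOn, Set.mem_inter_iff, Set.mem_iInter, Set.mem_ofPred_eq]
    exact ⟨fun H => ⟨(H 0).1, (H 0).2.1, fun j => (H j).2.2⟩,
      fun H j => ⟨H.1, H.2.1, H.2.2 j⟩⟩
  have hev : ∀ u ≤ h, ∀ c, MeasurableSet[past Z (s + h)] {ω | Z (s + u) ω = c} := fun u hu c =>
    measurableSet_past_eq Z (by gcongr) c
  rw [this]
  refine (hev _ zero_le _).inter ((hev _ le_rfl _).inter ?_)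
  refine .iInter fun j => .biInter (Set.countable_range _) fun x _ =>
    .biInter (Set.countable_range _) fun y _ => ?_
  by_cases hxy : x ≤ y ∧ y ≤ h
  · simp only [zero_le, hxy, true_imp_iff]
    have hx := hxy.1.trans hxy.2
    exact ((hev x hx n).union (hev x hx m)).inter ((hev x hx m).imp (hev y hxy.2 m))
  -- Grid points beyond `h` impose no condition; hence the event depends only on the path up to `s +
  -- h`.
  · convert MeasurableSet.univ using 1
    ext ω
    simp only [Set.mem_ofPred_eq, Set.mem_univ, iff_true]
    exact fun _ h1 h2 => absurd ⟨h1, h2⟩ hxy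

variable [IsProbabilityMeasure μ]

theorem real_stepEvent_le (hZ : IsMarkovChain Z μ P) (s : ℝ≥0) (n m : E) (h : ℝ≥0) :
    μ.real (stepEvent Z s n m h) ≤ μ.real {ω | Z s ω = n} * P h n m := by
  rw [← hZ.real_inter_eq (measurableSet_past_eq Z le_rfl n) subset_rfl]
  exact measureReal_mono (Set.subset_inter (stepEvent_subset_left s n m h)
    (stepEvent_subset_right s n m h))

theorem real_grid_eq (hZ : IsMarkovChain Z μ P) (s δ : ℝ≥0) (x : ℕ → E) (N : ℕ) :
    μ.real {ω | ∀ i ≤ N, Z (s + i * δ) ω = x i} =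
      μ.real {ω | Z s ω = x 0} * ∏ i ∈ Finset.range N, P δ (x i) (x (i + 1)) := by
  induction N with
  | zero => simp
  | succ N ih =>
    have hm : MeasurableSet[past Z (s + N * δ)] {ω | ∀ i ≤ N, Z (s + i * δ) ω = x i} := by
      simp only [Set.ofPred_forall]
      exact .iInter fun i => .iInter fun hi => measurableSet_past_eq Z (by gcongr) _
    have h1 := hZ.real_inter_eq hm (x := x N) (fun ω hω => hω N le_rfl) δ (x (N + 1))
    rw [Finset.prod_range_succ, ← mul_assoc, ← ih, ← h1]
    congr 1
    ext ω
    simp only [Set.mem_inter_iff, Set.mem_ofPred_eq]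
    have e : s + (N * δ) + δ = s + ((N + 1 : ℕ) : ℝ≥0) * δ := by push_cast; ring
    rw [e]
    constructor
    · exact fun H => ⟨fun i hi => H i (hi.trans N.le_succ), H _ le_rfl⟩
    · rintro ⟨H1, H2⟩ i hi
      rcases Nat.le_succ_iff.1 hi with hi | rfl
      · exact H1 i hi
      · exact H2

theorem tendsto_real_stepOn_dyadicGrid (hZ : IsMarkovChain Z μ P) (s : ℝ≥0) (n m : E) {h : ℝ≥0}
    (hh : 0 < h) :
    Tendsto (fun j => μ.real {ω | StepOn (dyadicGrid h j) (fun u => Z (s + u) ω) n m 0 h}) atTop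
      (𝓝 (μ.real (stepEvent Z s n m h))) := by
  have : stepEvent Z s n m h =
      ⋂ j, {ω | StepOn (dyadicGrid h j) (fun u => Z (s + u) ω) n m 0 h} := by
    ext ω
    simp only [Set.mem_iInter, Set.mem_ofPred_eq, stepEvent]
    exact stepOn_univ_iff_forall_dyadicGrid ((hZ.rightCont ω).shift s) hh n m
  rw [this]
  refine (ENNReal.tendsto_toReal (measure_ne_top _ _)).comp
    (tendsto_measure_iInter_atTop (fun j => ?_) ?_ ⟨0, measure_ne_top _ _⟩)
  · exact (hZ.measurable_shift s
      (measurableSet_stepOn (Set.countable_range _) n m 0 h)).nullMeasurableSet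
  · intro i j hij ω hω
    exact StepOn.mono (w := fun u => Z (s + u) ω) (monotone_dyadicGrid h hij) hω

/-- Being in `n` at all points of the grid with `N = 2 ^ j` intervals has conditional probability `P
(h / N) n n ^ N`; let `j → ∞`. -/
theorem mul_exp_le_real_stepEvent_self (hZ : IsMarkovChain Z μ P) (hQ : HasTransitionRates P Q)
    (s : ℝ≥0) (n : E) {h : ℝ≥0} (hh : 0 < h) :
    μ.real {ω | Z s ω = n} * Real.exp (-(h * totalRate Q n)) ≤ μ.real (stepEvent Z s n n h) := by
  have hlim := ((hQ.tendsto_pow n hh).comp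
    (tendsto_pow_atTop_atTop_of_one_lt one_lt_two)).const_mul (μ.real {ω | Z s ω = n})
  refine le_of_tendsto_of_tendsto' hlim (hZ.tendsto_real_stepOn_dyadicGrid s n n hh) fun j => ?_
  have h1 := hZ.real_grid_eq s (h / 2 ^ j) (fun _ => n) (2 ^ j)
  simp only [Finset.prod_const, Finset.card_range] at h1
  simp only [Function.comp, Nat.cast_pow, Nat.cast_ofNat]
  rw [← h1]
  refine measureReal_mono fun ω hω => ?_
  change StepOn _ (fun u => Z (s + u) ω) _ _ _ _
  refine stepOn_dyadicGrid (k := 0) hh ?_ ?_ fun i hi => by simpa using hω i hi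
  · simpa using hω 0 (by simp)
  · have := hω _ le_rfl
    push_cast at this
    rwa [mul_div_cancel₀ _ (by positivity)] at this

/-- On a grid with `N` intervals the change from `n` to `m` can fall into any of them. These are `N`
disjoint events, and `N * P (h / N) n m → h * Q n m`. The exponential factors are the cost of
staying put before and after the change; they tend to `1` as `h → 0`. -/
theorem mul_rate_le_real_stepEvent (hZ : IsMarkovChain Z μ P) (hP : IsTransitionFunction P)
    (hQ : HasTransitionRates P Q) (s : ℝ≥0) {n m : E} (hnm : n ≠ m) {h : ℝ≥0} (hh : 0 < h) :
    μ.real {ω | Z s ω = n} * (h * Q n m *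
      (Real.exp (-(h * totalRate Q n)) * Real.exp (-(h * totalRate Q m)))) ≤
      μ.real (stepEvent Z s n m h) := by
  have hN : Tendsto (fun N : ℕ => (N : ℝ) * P (h / N) n m) atTop (𝓝 (h * Q n m)) := by
    refine (((hQ.tendsto_off_diag n m hnm).comp
      (tendsto_div_natCast_nhdsGT hh)).const_mul (h : ℝ)).congr' ?_
    filter_upwards [eventually_gt_atTop 0] with N hN
    have : (N : ℝ) ≠ 0 := by positivity
    have : (h : ℝ) ≠ 0 := by exact_mod_cast hh.ne'
    simp only [Function.comp]
    push_cast
    field_simp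
  have hlim := ((hN.mul ((hQ.tendsto_pow n hh).mul (hQ.tendsto_pow m hh))).comp
    (tendsto_pow_atTop_atTop_of_one_lt one_lt_two)).const_mul (μ.real {ω | Z s ω = n})
  refine le_of_tendsto_of_tendsto' hlim (hZ.tendsto_real_stepOn_dyadicGrid s n m hh) fun j => ?_
  simp only [Function.comp]
  set N := 2 ^ j with hNj
  have hδ : h / ((N : ℕ) : ℝ≥0) = h / 2 ^ j := by simp [hNj]
  rw [hδ]
  set δ := h / 2 ^ j with hδ'
  let x : ℕ → ℕ → E := fun k i => if i ≤ k then n else m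
  let G : ℕ → Set Ω := fun k => {ω | ∀ i ≤ N, Z (s + i * δ) ω = x k i}
  have hGm : ∀ k, MeasurableSet (G k) := fun k => by
    simp only [G, Set.ofPred_forall]
    exact .iInter fun i => .iInter fun _ => hZ.measurableSet_eq _ _
  have hG : ∀ k < N, μ.real {ω | Z s ω = n} * (P δ n m * (P δ n n * P δ m m) ^ N) ≤
      μ.real (G k) := by
    intro k hk
    have h1 := hZ.real_grid_eq s δ (x k) N
    rw [h1]
    simp only [x, Nat.zero_le, if_true]
    gcongr
    rw [← Finset.mul_prod_erase _ _ (Finset.mem_range.2 hk)]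
    have hpp : P δ n n * P δ m m ≤ 1 :=
      mul_le_one₀ (hP.le_one _ _ _) (hP.nonneg _ _ _) (hP.le_one _ _ _)
    have hpp0 : 0 ≤ P δ n n * P δ m m := mul_nonneg (hP.nonneg _ _ _) (hP.nonneg _ _ _)
    simp only [le_refl, if_true, Nat.succ_le_iff, lt_irrefl, if_false]
    refine mul_le_mul_of_nonneg_left ?_ (hP.nonneg _ _ _)
    -- Each of the other `N - 1` intervals contributes one of the two diagonal entries. Their
    -- product is a cruder bound independent of `k`, and the exponent `N` fits the limit in
    -- `tendsto_pow`.
    calc (P δ n n * P δ m m) ^ N ≤ (P δ n n * P δ m m) ^ (N - 1) :=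
          pow_le_pow_of_le_one hpp0 hpp (Nat.sub_le _ _)
      _ = ∏ i ∈ (Finset.range N).erase k, P δ n n * P δ m m := by
          rw [Finset.prod_const, Finset.card_erase_of_mem (Finset.mem_range.2 hk),
            Finset.card_range]
      _ ≤ _ := by
          refine Finset.prod_le_prod (fun _ _ => hpp0) fun i hi => ?_
          have hik := Finset.ne_of_mem_erase hi
          rcases lt_or_gt_of_ne hik with h2 | h2
          · rw [if_pos h2.le, if_pos h2]
            exact mul_le_of_le_one_right (hP.nonneg _ _ _) (hP.le_one _ _ _)
          · rw [if_neg (by omega), if_neg (by omega)]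
            exact mul_le_of_le_one_left (hP.nonneg _ _ _) (hP.le_one _ _ _)
  have hdisj : Set.PairwiseDisjoint (Finset.range N : Set ℕ) G := by
    intro k hk l hl hkl
    rw [Function.onFun, Set.disjoint_left]
    intro ω h1 h2
    simp only [Finset.coe_range, Set.mem_Iio] at hk hl
    wlog hlt : k < l generalizing k l
    · exact this hkl.symm h2 h1 hl hk (by omega)
    have e := (h1 l hl.le).symm.trans (h2 l hl.le)
    simp only [x, le_refl, if_true, if_neg (not_le.2 hlt)] at e
    exact hnm e.symm
  calc _ = ∑ k ∈ Finset.range N,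
        μ.real {ω | Z s ω = n} * (P δ n m * (P δ n n * P δ m m) ^ N) := by
        rw [Finset.sum_const, Finset.card_range, nsmul_eq_mul, mul_pow]
        ring
    _ ≤ ∑ k ∈ Finset.range N, μ.real (G k) :=
        Finset.sum_le_sum fun k hk => hG k (Finset.mem_range.1 hk)
    _ = μ.real (⋃ k ∈ Finset.range N, G k) :=
        (measureReal_biUnion_finset hdisj fun k _ => hGm k).symm
    _ ≤ _ := by
        refine measureReal_mono (Set.iUnion₂_subset fun k hk ω hω => ?_)
        have hk := Finset.mem_range.1 hk
        change StepOn _ (fun u => Z (s + u) ω) _ _ _ _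
        refine stepOn_dyadicGrid (k := k) hh ?_ ?_ fun i hi => hω i hi
        · simpa [x] using hω 0 (by simp)
        · have := hω N le_rfl
          simp only [x, if_neg (not_le.2 hk)] at this
          rw [← this]
          congr 2
          rw [hδ', hNj]
          push_cast
          field_simp

end IsMarkovChain

end CTMC

/-! ### Scheffé's lemma and limits at zero -/

namespace CTMC

/-- Scheffé's lemma for series. -/
theorem tendsto_tsum_abs_sub_of_tsum_le {ι M : Type*} {l : Filter ι} {a : ι → M → ℝ}
    {q : M → ℝ} {b : ι → ℝ} (hq : Summable q) (ha0 : ∀ i m, 0 ≤ a i m)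
    (ha : ∀ m, Tendsto (fun i => a i m) l (𝓝 (q m))) (hs : ∀ᶠ i in l, Summable (a i))
    (hab : ∀ᶠ i in l, ∑' m, a i m ≤ b i) (hb : Tendsto b l (𝓝 (∑' m, q m))) :
    Tendsto (fun i => ∑' m, |a i m - q m|) l (𝓝 0) := by
  rcases l.eq_or_neBot with rfl | hl
  · exact tendsto_bot
  have hq0 : ∀ m, 0 ≤ q m := fun m => ge_of_tendsto' (ha m) fun i => ha0 i m
  have hle : ∀ i m, |max (q m - a i m) 0| ≤ q m := fun i m => by
    rw [abs_of_nonneg (le_max_right _ _)]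
    exact max_le (by linarith [ha0 i m]) (hq0 m)
  have h1 : Tendsto (fun i => ∑' m, max (q m - a i m) 0) l (𝓝 0) := by
    have := tendsto_tsum_of_dominated_convergence (𝓕 := l) (f := fun i m => max (q m - a i m) 0)
      (g := fun _ => 0) hq (fun m => by
        simpa using ((ha m).const_sub (q m)).max (tendsto_const_nhds (x := (0 : ℝ))))
        (Eventually.of_forall fun i m => hle i m)
    simpa using this
  have h2 : Tendsto (fun i => (b i - ∑' m, q m) + 2 * ∑' m, max (q m - a i m) 0) l (𝓝 0) := by
    simpa using (hb.sub_const (∑' m, q m)).add (h1.const_mul 2)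
  refine tendsto_of_tendsto_of_tendsto_of_le_of_le' tendsto_const_nhds h2
    (Eventually.of_forall fun i => tsum_nonneg fun m => abs_nonneg _) ?_
  filter_upwards [hs, hab] with i hsi habi
  have hmax : Summable fun m => max (q m - a i m) 0 :=
    .of_norm_bounded hq fun m => hle i m
  -- The negative part is dominated by `q`, so only the signed sum remains, and `b` controls it.
  have h3 : ∀ m, |a i m - q m| = (a i m - q m) + 2 * max (q m - a i m) 0 := fun m => by
    rcases le_total (q m) (a i m) with h | h
    · rw [abs_of_nonneg (by linarith), max_eq_right (by linarith)]; ring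
    · rw [abs_of_nonpos (by linarith), max_eq_left (by linarith)]; ring
  simp only [h3]
  rw [(hsi.sub hq).tsum_add (hmax.mul_left 2), hsi.tsum_sub hq, tsum_mul_left]
  linarith

theorem tendsto_tsum_mul_of_tendsto_tsum_abs_sub {ι M : Type*} {l : Filter ι} {a : ι → M → ℝ}
    {q : M → ℝ} (hq : Summable q) (hs : ∀ᶠ i in l, Summable (a i))
    (h : Tendsto (fun i => ∑' m, |a i m - q m|) l (𝓝 0)) {c : M → ℂ} (hc : ∀ m, ‖c m‖ ≤ 1) :
    Tendsto (fun i => ∑' m, c m * (a i m : ℂ)) l (𝓝 (∑' m, c m * (q m : ℂ))) := by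
  rw [tendsto_iff_norm_sub_tendsto_zero]
  refine tendsto_of_tendsto_of_tendsto_of_le_of_le' tendsto_const_nhds h
    (Eventually.of_forall fun i => norm_nonneg _) ?_
  filter_upwards [hs] with i hsi
  have hle : ∀ (u : M → ℝ) m, ‖c m * (u m : ℂ)‖ ≤ |u m| := fun u m => by
    rw [norm_mul, Complex.norm_real, Real.norm_eq_abs]
    exact mul_le_of_le_one_left (abs_nonneg _) (hc m)
  have hsum : ∀ u : M → ℝ, Summable u → Summable fun m => c m * (u m : ℂ) := fun u hu =>
    .of_norm_bounded hu.abs (hle u)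
  rw [← (hsum _ hsi).tsum_sub (hsum _ hq)]
  refine tsum_of_norm_bounded ((hsi.sub hq).abs.hasSum) fun m => ?_
  rw [← mul_sub, ← Complex.ofReal_sub]
  exact hle (fun m => a i m - q m) m

theorem tendsto_slope_nnreal {V : Type*} [NormedAddCommGroup V] [NormedSpace ℝ V] {f : ℝ → V}
    {f' : V} (hf : HasDerivAt f f' 0) :
    Tendsto (fun h : ℝ≥0 => (h : ℝ)⁻¹ • (f h - f 0)) (𝓝[>] 0) (𝓝 f') := by
  have h1 := hasDerivAt_iff_tendsto_slope_zero.1 hf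
  have h2 : Tendsto (fun h : ℝ≥0 => (h : ℝ)) (𝓝[>] 0) (𝓝[≠] 0) := by
    rw [tendsto_nhdsWithin_iff]
    refine ⟨(NNReal.continuous_coe.tendsto' 0 0 rfl).mono_left nhdsWithin_le_nhds, ?_⟩
    filter_upwards [self_mem_nhdsWithin] with h hh
    simpa using (Set.mem_Ioi.1 hh).ne'
  simpa [Function.comp_def] using h1.comp h2

theorem tendsto_one_sub_cexp_div (ν : ℂ) :
    Tendsto (fun h : ℝ≥0 => (1 - Complex.exp (-ν * (h : ℝ))) / ((h : ℝ) : ℂ)) (𝓝[>] 0)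
      (𝓝 ν) := by
  have h1 : HasDerivAt (fun x : ℝ => Complex.exp (-ν * (x : ℂ))) (-ν) 0 := by
    have := (((hasDerivAt_id (0 : ℂ)).const_mul (-ν)).cexp).comp_ofReal
    simpa using this
  refine ((tendsto_slope_nnreal h1).neg.congr fun h => ?_).trans (by simp)
  simp
  ring

theorem tendsto_one_sub_exp_div (d : ℝ) :
    Tendsto (fun h : ℝ≥0 => (1 - Real.exp (-(h * d))) / (h : ℝ)) (𝓝[>] 0) (𝓝 d) := by
  have h1 : HasDerivAt (fun x : ℝ => Real.exp (-(x * d))) (-d) 0 := by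
    simpa using (((hasDerivAt_id (0 : ℝ)).mul_const d).neg).exp
  refine ((tendsto_slope_nnreal h1).neg.congr fun h => ?_).trans (by simp)
  simp
  ring

variable {Ω : Type*} [MeasurableSpace Ω] {μ : Measure Ω} {E : Set ℕ} {Z : ℝ≥0 → Ω → E}
  {P : ℝ≥0 → E → E → ℝ} {Q : E → E → ℝ}

theorem HasTransitionRates.nonneg (hQ : HasTransitionRates P Q) (hP : IsTransitionFunction P)
    (n m : E) : 0 ≤ Q n m := by
  by_cases h : n = m
  · rw [h, hQ.diag]
  · exact ge_of_tendsto' (hQ.tendsto_off_diag n m h) fun t => div_nonneg (hP.nonneg t n m) t.2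

/-! ### Decomposition over a short interval and passage to the limit -/

open Classical in
/-- The value at `ν` of the transform of the remaining time until the next jump in `F`, just after
a transition from `n` to `m`. -/
noncomputable def transitionLST (Z : ℝ≥0 → Ω → E) (μ : Measure Ω) (F : Set (E × E)) (n m : E)
    (ν : ℂ) : ℂ :=
  if (n, m) ∈ F then 1 else stateLST Z μ F m ν

namespace IsMarkovChain

theorem measurableSet_stepEvent (hZ : IsMarkovChain Z μ P) (s : ℝ≥0) (n m : E) {h : ℝ≥0}
    (hh : 0 < h) : MeasurableSet (stepEvent Z s n m h) :=
  hZ.past_le _ _ (hZ.measurableSet_past_stepEvent s n m hh)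

variable [IsProbabilityMeasure μ]

/-- An error arises only for transitions in `F`. That it vanishes for `m = n` matters: this event
has mass of order one, so an error of relative size `h` would survive division by `h`. -/
theorem norm_setIntegral_stepEvent_sub_le (hZ : IsMarkovChain Z μ P) {F : Set (E × E)}
    (hF : ∀ p ∈ F, p.1 ≠ p.2) {ν : ℂ} (hν : 0 ≤ ν.re) (s : ℝ≥0) (n m : E) {h : ℝ≥0}
    (hh : 0 < h) (hνh : ‖ν‖ * h ≤ 1) :
    ‖∫ ω in stepEvent Z s n m h, laplaceKernel ν (timeToNextJump Z F s ω) ∂μ -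
      Complex.exp (-ν * (h : ℝ)) *
        (transitionLST Z μ F n m ν * μ.real (stepEvent Z s n m h))‖ ≤
      2 * ‖ν‖ * h * (if m = n then 0 else μ.real (stepEvent Z s n m h)) := by
  have hm := hZ.measurableSet_stepEvent s n m hh
  unfold transitionLST
  split_ifs with hnm hmn hmn
  · exact absurd hmn.symm (hF _ hnm)
  · have h1 : Complex.exp (-ν * (h : ℝ)) * (1 * μ.real (stepEvent Z s n m h)) =
        ∫ ω in stepEvent Z s n m h, Complex.exp (-ν * (h : ℝ)) ∂μ := by
      rw [setIntegral_const, Complex.real_smul, one_mul, mul_comm]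
    rw [h1, ← integral_sub (hZ.integrable_laplaceKernel hF hν s) (integrable_const _)]
    refine norm_setIntegral_le_of_norm_le_const (measure_lt_top _ _) fun ω hω => ?_
    refine norm_laplaceKernel_sub_le hν ?_ hνh
    rw [timeToNextJump_eq_nextJump (hZ.rightCont ω)]
    exact nextJump_le_of_stepOn ((hZ.rightCont ω).shift s) zero_le hnm (hF _ hnm) hω
  all_goals
    have h1 : ∫ ω in stepEvent Z s n m h, laplaceKernel ν (timeToNextJump Z F s ω) ∂μ =
        ∫ ω in stepEvent Z s n m h, Complex.exp (-ν * (h : ℝ)) *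
          laplaceKernel ν (timeToNextJump Z F (s + h) ω) ∂μ := by
      refine setIntegral_congr_fun hm fun ω hω => ?_
      rw [timeToNextJump_eq_nextJump (hZ.rightCont ω), timeToNextJump_eq_nextJump (hZ.rightCont ω),
        nextJump_eq_add_of_stepOn (w := fun u => Z (s + u) ω) hF hnm hω, laplaceKernel_add]
      simp only [add_assoc]
    rw [h1, integral_const_mul, hZ.setIntegral_laplaceKernel hF ν
      (hZ.measurableSet_past_stepEvent s n m hh) (stepEvent_subset_right s n m h)]
    rw [mul_comm (μ.real _ : ℂ), sub_self, norm_zero]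
    positivity

theorem hasSum_real_stepEvent (hZ : IsMarkovChain Z μ P) (s : ℝ≥0) (n : E) {h : ℝ≥0}
    (hh : 0 < h) :
    HasSum (fun m => μ.real (stepEvent Z s n m h)) (μ.real (⋃ m, stepEvent Z s n m h)) := by
  have := hasSum_integral_iUnion (μ := μ) (f := fun _ => (1 : ℝ))
    (fun m => hZ.measurableSet_stepEvent s n m hh) (pairwise_disjoint_stepEvent s n h)
    (integrable_const _)
  simpa using this

/-- The first error term is the mass of `{Z s = n}` outside all step events, where the kernel is
bounded by `1`; the second sums the errors of the single transitions. -/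
theorem norm_stateLST_sub_tsum_le (hZ : IsMarkovChain Z μ P) {F : Set (E × E)}
    (hF : ∀ p ∈ F, p.1 ≠ p.2) {ν : ℂ} (hν : 0 ≤ ν.re) (s : ℝ≥0) (n : E) {h : ℝ≥0}
    (hh : 0 < h) (hνh : ‖ν‖ * h ≤ 1) :
    ‖μ.real {ω | Z s ω = n} * stateLST Z μ F n ν - Complex.exp (-ν * (h : ℝ)) *
        ∑' m, transitionLST Z μ F n m ν * μ.real (stepEvent Z s n m h)‖ ≤
      (μ.real {ω | Z s ω = n} - ∑' m, μ.real (stepEvent Z s n m h)) +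
        2 * ‖ν‖ * h * ∑' m, if m = n then 0 else μ.real (stepEvent Z s n m h) := by
  set U := ⋃ m, stepEvent Z s n m h
  set φ := fun ω => laplaceKernel ν (timeToNextJump Z F s ω)
  have hφi : Integrable φ μ := hZ.integrable_laplaceKernel hF hν s
  have hm := fun m => hZ.measurableSet_stepEvent s n m hh
  have hUm : MeasurableSet U := .iUnion hm
  have hUA : U ⊆ {ω | Z s ω = n} := Set.iUnion_subset fun m => stepEvent_subset_left s n m h
  have hsum := hZ.hasSum_real_stepEvent (μ := μ) s n hh
  have hsumφ : HasSum (fun m => ∫ ω in stepEvent Z s n m h, φ ω ∂μ) (∫ ω in U, φ ω ∂μ) :=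
    hasSum_integral_iUnion hm (pairwise_disjoint_stepEvent s n h) hφi.integrableOn
  have hbound : ∀ m, ‖transitionLST Z μ F n m ν * (μ.real (stepEvent Z s n m h) : ℂ)‖ ≤
      μ.real (stepEvent Z s n m h) := fun m => by
    rw [norm_mul, Complex.norm_real, Real.norm_of_nonneg measureReal_nonneg]
    refine mul_le_of_le_one_left measureReal_nonneg ?_
    unfold transitionLST
    split_ifs
    · simp
    · exact norm_stateLST_le F m hν
  have hsumg : Summable fun m => transitionLST Z μ F n m ν *
      (μ.real (stepEvent Z s n m h) : ℂ) := .of_norm_bounded hsum.summable hbound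
  have hoff : Summable fun m => if m = n then 0 else μ.real (stepEvent Z s n m h) :=
    .of_nonneg_of_le (fun m => by split_ifs <;> simp) (fun m => by
      split_ifs <;> simp) hsum.summable
  have h1 : (μ.real {ω | Z s ω = n} : ℂ) * stateLST Z μ F n ν =
      ∫ ω in U, φ ω ∂μ + ∫ ω in {ω | Z s ω = n} \ U, φ ω ∂μ := by
    rw [← hZ.setIntegral_laplaceKernel hF ν (measurableSet_past_eq Z le_rfl n) subset_rfl,
      ← setIntegral_union Set.disjoint_sdiff_right
        ((hZ.measurableSet_eq s n).diff hUm) hφi.integrableOn hφi.integrableOn,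
      Set.union_sdiff_cancel hUA]
  rw [h1, ← tsum_mul_left, ← tsum_mul_left, hsum.tsum_eq, add_sub_right_comm, add_comm,
    ← hsumφ.tsum_eq, ← hsumφ.summable.tsum_sub (hsumg.mul_left _)]
  refine (norm_add_le _ _).trans (add_le_add ?_ ?_)
  · have := norm_setIntegral_le_of_norm_le_const (μ := μ) (s := {ω | Z s ω = n} \ U) (f := φ)
      (C := 1) (measure_lt_top _ _) fun ω _ => norm_laplaceKernel_le hν _
    rwa [one_mul, measureReal_sdiff hUA hUm] at this
  · exact tsum_of_norm_bounded (hoff.mul_left _).hasSum fun m =>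
      hZ.norm_setIntegral_stepEvent_sub_le hF hν s n m hh hνh

theorem tendsto_real_stepEvent_div (hZ : IsMarkovChain Z μ P) (hP : IsTransitionFunction P)
    (hQ : HasTransitionRates P Q) {s : ℝ≥0} {n m : E} (hnm : n ≠ m)
    (hn : 0 < μ.real {ω | Z s ω = n}) :
    Tendsto (fun h : ℝ≥0 => μ.real (stepEvent Z s n m h) / (μ.real {ω | Z s ω = n} * h))
      (𝓝[>] 0) (𝓝 (Q n m)) := by
  have hexp : ∀ d : ℝ, Tendsto (fun h : ℝ≥0 => Real.exp (-(h * d))) (𝓝[>] 0) (𝓝 1) := fun d => by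
    have : Continuous fun h : ℝ≥0 => Real.exp (-(h * d)) := by fun_prop
    exact (this.tendsto' 0 1 (by simp)).mono_left nhdsWithin_le_nhds
  have h1 := ((hexp (totalRate Q n)).mul (hexp (totalRate Q m))).const_mul (Q n m)
  simp only [mul_one] at h1
  refine tendsto_of_tendsto_of_tendsto_of_le_of_le' h1 (hQ.tendsto_off_diag n m hnm) ?_ ?_
  all_goals
    filter_upwards [self_mem_nhdsWithin] with h hh
    have hh : 0 < h := hh
    have hh' : (0 : ℝ) < h := hh
  · rw [le_div_iff₀ (by positivity)]
    exact le_of_eq_of_le (by ring) (hZ.mul_rate_le_real_stepEvent hP hQ s hnm hh)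
  · rw [div_le_div_iff₀ (by positivity) hh']
    have := mul_le_mul_of_nonneg_right (hZ.real_stepEvent_le s n m h) hh'.le
    linarith

theorem tendsto_one_sub_real_stepEvent_div (hZ : IsMarkovChain Z μ P)
    (hQ : HasTransitionRates P Q) {s : ℝ≥0} {n : E} (hn : 0 < μ.real {ω | Z s ω = n}) :
    Tendsto (fun h : ℝ≥0 =>
      (1 - μ.real (stepEvent Z s n n h) / μ.real {ω | Z s ω = n}) / (h : ℝ))
      (𝓝[>] 0) (𝓝 (totalRate Q n)) := by
  refine tendsto_of_tendsto_of_tendsto_of_le_of_le' (hQ.tendsto_diag n)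
    (tendsto_one_sub_exp_div (totalRate Q n)) ?_ ?_
  all_goals
    filter_upwards [self_mem_nhdsWithin] with h hh
    have hh : 0 < h := hh
    gcongr
  · rw [div_le_iff₀' hn]
    exact hZ.real_stepEvent_le s n n h
  · rw [le_div_iff₀' hn]
    exact hZ.mul_exp_le_real_stepEvent_self hQ s n hh

/-- The estimate of `norm_stateLST_sub_tsum_le` is divided by `α * h`. The term `m = n` is merged
with the left side, where it produces `totalRate Q n + ν`; the other terms converge to the series.
-/
theorem stateLST_mul_eq (hZ : IsMarkovChain Z μ P) (hP : IsTransitionFunction P)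
    (hQ : HasTransitionRates P Q) {F : Set (E × E)} (hF : ∀ p ∈ F, p.1 ≠ p.2) {ν : ℂ}
    (hν : 0 ≤ ν.re) {s : ℝ≥0} {n : E} (hn : μ {ω | Z s ω = n} ≠ 0) :
    stateLST Z μ F n ν * (totalRate Q n + ν) =
      ∑' m, transitionLST Z μ F n m ν * (Q n m : ℂ) := by
  have hnF : (n, n) ∉ F := fun h => hF _ h rfl
  have hα : 0 < μ.real {ω | Z s ω = n} := ENNReal.toReal_pos hn (measure_ne_top _ _)
  set α := μ.real {ω | Z s ω = n}
  set f := stateLST Z μ F n ν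
  let S : ℝ≥0 → E → ℝ := fun h m => μ.real (stepEvent Z s n m h)
  let a : ℝ≥0 → E → ℝ := fun h m => (if m = n then 0 else S h m) / (α * h)
  let b : ℝ≥0 → ℝ := fun h => (1 - S h n / α) / h
  have hb : Tendsto b (𝓝[>] 0) (𝓝 (totalRate Q n)) := hZ.tendsto_one_sub_real_stepEvent_div hQ hα
  have hpos : ∀ᶠ h : ℝ≥0 in 𝓝[>] 0, 0 < h := self_mem_nhdsWithin
  have hS : ∀ h : ℝ≥0, 0 < h → Summable (S h) := fun h hh =>
    (hZ.hasSum_real_stepEvent s n hh).summable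
  have hoff : ∀ h : ℝ≥0, 0 < h → Summable fun m => if m = n then 0 else S h m := fun h hh =>
    .of_nonneg_of_le (fun m => by split_ifs <;> simp [S]) (fun m => by
      split_ifs <;> simp [S]) (hS h hh)
  have hsplit : ∀ h : ℝ≥0, 0 < h → ∑' m, S h m = S h n + α * h * ∑' m, a h m := by
    intro h hh
    have hh' : (h : ℝ) ≠ 0 := by exact_mod_cast hh.ne'
    rw [(hS h hh).tsum_eq_add_tsum_ite n, tsum_div_const,
      mul_div_cancel₀ _ (by positivity)]
  have ha : ∀ m, Tendsto (fun h => a h m) (𝓝[>] 0) (𝓝 (Q n m)) := by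
    intro m
    by_cases hmn : m = n
    · simp [a, hmn, hQ.diag]
    · simpa [a, hmn] using hZ.tendsto_real_stepEvent_div hP hQ (Ne.symm hmn) hα
  have hs : ∀ᶠ h in 𝓝[>] 0, Summable (a h) := by
    filter_upwards [hpos] with h hh using (hoff h hh).div_const _
  have hle : ∀ h : ℝ≥0, 0 < h → ∑' m, S h m ≤ α := fun h hh => by
    rw [(hZ.hasSum_real_stepEvent s n hh).tsum_eq]
    exact measureReal_mono (Set.iUnion_subset fun m => stepEvent_subset_left s n m h)
  -- The step events are disjoint parts of `{Z s = n}`: those that leave `n` have at most the mass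
  -- not spent on staying. As `b` tends to the sum of the termwise limits of `a`, Scheffé's lemma
  -- applies.
  have hab : ∀ᶠ h in 𝓝[>] 0, ∑' m, a h m ≤ b h := by
    filter_upwards [hpos] with h hh
    have h1 := hle h hh
    rw [hsplit h hh] at h1
    have hh' : (0 : ℝ) < h := hh
    rw [le_div_iff₀ hh', ← mul_le_mul_iff_right₀ hα, mul_sub, mul_div_cancel₀ _ hα.ne']
    linarith
  have ha0 : ∀ h m, 0 ≤ a h m := fun h m => by
    refine div_nonneg ?_ (by positivity)
    split_ifs <;> simp [S]
  have hsch := tendsto_tsum_abs_sub_of_tsum_le (hQ.summable n) ha0 ha hs hab hb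
  have hg1 : ∀ m, ‖transitionLST Z μ F n m ν‖ ≤ 1 := fun m => by
    unfold transitionLST
    split_ifs
    · simp
    · exact norm_stateLST_le F m hν
  have hlimg := tendsto_tsum_mul_of_tendsto_tsum_abs_sub (hQ.summable n) hs hsch hg1
  have hlima : Tendsto (fun h => ∑' m, a h m) (𝓝[>] 0) (𝓝 (totalRate Q n)) := by
    have := tendsto_tsum_mul_of_tendsto_tsum_abs_sub (hQ.summable n) hs hsch (c := fun _ => 1)
      (fun _ => by simp)
    simp only [one_mul, ← Complex.ofReal_tsum] at this
    exact (Complex.continuous_re.tendsto _).comp this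
  have hcoe : Tendsto (fun h : ℝ≥0 => (h : ℝ)) (𝓝[>] 0) (𝓝 0) :=
    (NNReal.continuous_coe.tendsto' 0 0 rfl).mono_left nhdsWithin_le_nhds
  have hexp : Tendsto (fun h : ℝ≥0 => Complex.exp (-ν * (h : ℝ))) (𝓝[>] 0) (𝓝 1) := by
    have : Continuous fun h : ℝ≥0 => Complex.exp (-ν * (h : ℝ)) := by fun_prop
    exact (this.tendsto' 0 1 (by simp)).mono_left nhdsWithin_le_nhds
  have hbC : Tendsto (fun h => (b h : ℂ)) (𝓝[>] 0) (𝓝 (totalRate Q n : ℂ)) :=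
    (Complex.continuous_ofReal.tendsto _).comp hb
  have hL := (((tendsto_one_sub_cexp_div ν).add (hexp.mul hbC)).const_mul f).sub (hexp.mul hlimg)
  have hR := (hb.sub hlima).add ((hcoe.const_mul (2 * ‖ν‖)).mul hlima)
  simp only [sub_self, mul_zero, zero_mul, add_zero] at hR
  suffices hbound : ∀ᶠ h : ℝ≥0 in 𝓝[>] 0,
      ‖f * ((1 - Complex.exp (-ν * (h : ℝ))) / ((h : ℝ) : ℂ) +
          Complex.exp (-ν * (h : ℝ)) * (b h : ℂ)) -
        Complex.exp (-ν * (h : ℝ)) * ∑' m, transitionLST Z μ F n m ν * (a h m : ℂ)‖ ≤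
      (b h - ∑' m, a h m) + 2 * ‖ν‖ * h * ∑' m, a h m by
    have := tendsto_nhds_unique hL (squeeze_zero_norm' hbound hR)
    rw [one_mul, one_mul, sub_eq_zero] at this
    rw [← this, add_comm ν]
  · have hsmall : ∀ᶠ h : ℝ≥0 in 𝓝[>] 0, ‖ν‖ * h ≤ 1 := by
      have := hcoe.const_mul ‖ν‖
      rw [mul_zero] at this
      exact (this.eventually_lt_const one_pos).mono fun _ h => h.le
    filter_upwards [hpos, hsmall] with h hh hνh
    have hh' : (0 : ℝ) < h := hh
    have hmain := hZ.norm_stateLST_sub_tsum_le hF hν s n hh hνh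
    have hpos' : 0 < α * h := by positivity
    have hαC : (α : ℂ) ≠ 0 := by exact_mod_cast hα.ne'
    have hhC : ((h : ℝ) : ℂ) ≠ 0 := by exact_mod_cast hh'.ne'
    have hgs : Summable fun m => transitionLST Z μ F n m ν * (S h m : ℂ) := by
      refine .of_norm_bounded (hS h hh) fun m => ?_
      rw [norm_mul, Complex.norm_real, Real.norm_of_nonneg measureReal_nonneg]
      exact mul_le_of_le_one_left measureReal_nonneg (hg1 m)
    -- Staying in `n` is not a transition in `F`, so its coefficient is `f` itself.
    have e1 : ∑' m, transitionLST Z μ F n m ν * (S h m : ℂ) =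
        f * S h n + α * (h : ℝ) * ∑' m, transitionLST Z μ F n m ν * (a h m : ℂ) := by
      rw [hgs.tsum_eq_add_tsum_ite n, ← tsum_mul_left]
      congr 1
      · rw [transitionLST, if_neg hnF]
      · refine tsum_congr fun m => ?_
        simp only [a]
        split_ifs
        · simp
        · push_cast
          field_simp
    have e2 : ∑' m, (if m = n then 0 else S h m) = α * h * ∑' m, a h m := by
      rw [tsum_div_const, mul_div_cancel₀ _ hpos'.ne']
    change ‖(α : ℂ) * f - Complex.exp (-ν * (h : ℝ)) *
        ∑' m, transitionLST Z μ F n m ν * (S h m : ℂ)‖ ≤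
      (α - ∑' m, S h m) + 2 * ‖ν‖ * h * ∑' m, (if m = n then 0 else S h m) at hmain
    rw [e1, e2, hsplit h hh] at hmain
    rw [← mul_le_mul_iff_right₀ hpos']
    have hnorm : ∀ x : ℂ, α * h * ‖x‖ = ‖((α * h : ℝ) : ℂ) * x‖ := fun x => by
      rw [norm_mul, Complex.norm_real, Real.norm_of_nonneg hpos'.le]
    have hbh : α * h * b h = α - S h n := by
      simp only [b]
      field_simp
    have hbhC : (α : ℂ) * (h : ℝ) * b h = α - S h n := by exact_mod_cast congrArg Complex.ofReal hbh
    refine (hnorm _).trans_le (le_of_eq_of_le (congrArg norm ?_) (hmain.trans_eq ?_))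
    · have hdiv : ((h : ℝ) : ℂ) * ((1 - Complex.exp (-ν * (h : ℝ))) / ((h : ℝ) : ℂ)) =
          1 - Complex.exp (-ν * (h : ℝ)) := mul_div_cancel₀ _ hhC
      push_cast
      linear_combination f * Complex.exp (-ν * (h : ℝ)) * hbhC + α * f * hdiv
    · linear_combination -hbh

end IsMarkovChain

end CTMC

/-! ### The theorem -/

theorem mainTheorem3 {Ω : Type*} [MeasurableSpace Ω] (μ : Measure Ω) [IsProbabilityMeasure μ]
    (E : Set ℕ) (Z : ℝ≥0 → Ω → E) (P : ℝ≥0 → E → E → ℝ) (Q : E → E → ℝ)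
    (hP : CTMC.IsTransitionFunction P) (hQ : CTMC.HasTransitionRates P Q)
    (hZ : CTMC.IsMarkovChain Z μ P)
    (hd : ∀ n, 0 < CTMC.totalRate Q n)
    (F : Set (E × E)) (hF : ∀ p ∈ F, 0 < Q p.1 p.2) :
    (∀ t, Measurable (CTMC.timeToNextJump Z F t)) ∧
    ∃ f : E → ℂ → ℂ,
      (∀ (n : E) (ν : ℂ), 0 ≤ ν.re → ∀ t : ℝ≥0, μ {ω | Z t ω = n} ≠ 0 →
        CTMC.condLST Z μ F t n ν = f n ν) ∧
      ∀ (n : E) (ν : ℂ), 0 ≤ ν.re → (∃ t : ℝ≥0, μ {ω | Z t ω = n} ≠ 0) →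
        Summable (fun m : E => f m ν * (Q n m : ℂ)) ∧
        f n ν = 1 / ((CTMC.totalRate Q n : ℂ) + ν) *
          ((∑' m : {m : E // (n, m) ∉ F}, f m ν * (Q n m : ℂ)) +
            ∑' m : {m : E // (n, m) ∈ F}, (Q n m : ℂ)) := by
  have hne : ∀ p ∈ F, p.1 ≠ p.2 := by
    intro p hp h
    have := hF p hp
    rw [h, hQ.diag] at this
    exact this.false
  refine ⟨hZ.measurable_timeToNextJump hne, CTMC.stateLST Z μ F, fun n ν _ t ht =>
    hZ.integral_cond_laplaceKernel hne ν (CTMC.measurableSet_past_eq Z le_rfl n) subset_rfl ht, ?_⟩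
  rintro n ν hν ⟨s, hs⟩
  have hsum : ∀ c : E → ℂ, (∀ m, ‖c m‖ ≤ 1) → Summable fun m => c m * (Q n m : ℂ) := by
    refine fun c hc => .of_norm_bounded (hQ.summable n) fun m => ?_
    rw [norm_mul, Complex.norm_real, Real.norm_of_nonneg (hQ.nonneg hP n m)]
    exact mul_le_of_le_one_left (hQ.nonneg hP n m) (hc m)
  refine ⟨hsum _ fun m => CTMC.norm_stateLST_le F m hν, ?_⟩
  -- The real part is positive, as `totalRate Q n > 0` and `0 ≤ ν.re`.
  have hne0 : (CTMC.totalRate Q n : ℂ) + ν ≠ 0 := fun h => by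
    have := congrArg Complex.re h
    simp only [Complex.add_re, Complex.ofReal_re, Complex.zero_re] at this
    linarith [hd n]
  have hg : Summable fun m => CTMC.transitionLST Z μ F n m ν * (Q n m : ℂ) := by
    refine hsum _ fun m => ?_
    unfold CTMC.transitionLST
    split_ifs
    · simp
    · exact CTMC.norm_stateLST_le F m hν
  have hmul := hZ.stateLST_mul_eq hP hQ hne hν hs
  rw [← hg.tsum_subtype_add_tsum_subtype_compl {m | (n, m) ∈ F},
    add_comm (∑' m : {m | (n, m) ∈ F}, _)] at hmul
  rw [one_div, eq_inv_mul_iff_mul_eq₀ hne0, mul_comm, hmul]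
  congr 1
  · exact tsum_congr fun m : {m : E // (n, m) ∉ F} => by
      rw [CTMC.transitionLST, if_neg m.2]
  · exact tsum_congr fun m : {m : E // (n, m) ∈ F} => by
      rw [CTMC.transitionLST, if_pos m.2, one_mul]
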